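/- Let $n>1$, $\beta>0$, and let $A(1),A(2),\ldots$ be real $n\times n$ matrices $A(t)=[a_{ij}(t)]$ such that for all $t\ge 1$ and all $i,j$: $a_{ii}(t)>0$, $\sum_{k=1}^n|a_{ik}(t)|=1$, and $|a_{ij}(t)|\ge\beta$ whenever $a_{ij}(t)\neq 0$. The neighbor graph $\mathbb G(t)$ is the signed digraph on $\{1,\ldots,n\}$ that has an arc $(i,j)$ exactly when $a_{ji}(t)\ne 0$, with the sign of $a_{ji}(t)$. Let $b\in\{1,-1\}^n$ with $b_1=1$. Suppose that every $\mathbb G(t)$, $t\ge1$, is strongly connected and structurally balanced with respect to $b$, i.e. each arc $(i,j)$ is positive if $b_i=b_j$ and negative if $b_i\neq b_j$. Let $p^*(t)$ be the minimum, over all directed (rooted) spanning trees contained in $\mathbb G(t)$, of the length of the longest directed path of the tree. Then $p^*=\max_{t\ge1}p^*(t)$ exists. The sequence of stochastic matrices $|A(t)|=[|a_{ij}(t)|]$ has an absolute probability sequence, i.e. a sequence of stochastic vectors $\pi(1),\pi(2),\ldots$ with $\pi(t)'=\pi(t+1)'|A(t)|$ for all $t\ge1$, and the entries of any such sequence have a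 uniform positive lower bound. For any such sequence and any $\delta>0$ with $\pi_i(t)\ge\delta$ for all $i$ and all $t\ge1$, put $$\rho=1-\frac{\delta\beta^2}{4p^*}.$$ Then $0<\rho<1$, and the system $x(t+1)=A(t)x(t)$, $t\ge 1$, reaches the nonzero modulus consensus corresponding to $b$ as fast as $\rho^t$ converges to zero for almost all initial conditions. That is, there is a nonzero vector $c\in\mathbb R^n$ such that for every solution $x$ there is a constant $C$ with $|x_i(t)-(c'x(1))\,b_i|\le C\rho^t$ for all $i$ and all $t\ge1$; and for Lebesgue-almost every $x(1)\in\mathbb R^n$ there are $\alpha\ne0$ and $C$ with $|x_i(t)-\alpha b_i|\le C\rho^t$ for all $i$ and all $t\ge1$. -/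

import Mathlib

open MeasureTheory Matrix

/-- A (simple) signed digraph on `V`: `sign i j` is the sign of the arc from `i` to `j`, and
`sign i j = 0` means that there is no arc from `i` to `j`. -/
structure SignedDigraph (V : Type*) where
  sign : V → V → SignType

namespace SignedDigraph

variable {V : Type*}

/-- `(i, j)` is an arc of `G`. -/
def Arc (G : SignedDigraph V) (i j : V) : Prop := G.sign i j ≠ 0

/-- There is a directed walk (equivalently, a directed path) from every vertex to every vertex. -/
def StronglyConnected (G : SignedDigraph V) : Prop :=
  ∀ i j, Relation.ReflTransGen G.Arc i j

/-- `G` is structurally balanced with respect to the clustering given by the signs of `b`: arcs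
inside a cluster are positive and arcs between the two clusters are negative. -/
def StructurallyBalanced (G : SignedDigraph V) (b : V → ℝ) : Prop :=
  ∀ i j, G.Arc i j → (b i = b j → G.sign i j = 1) ∧ (b i ≠ b j → G.sign i j = -1)

/-- The arcs `T` form a directed spanning tree of `G` with root `r`: all of them are arcs of `G`,
no arc enters `r`, exactly one arc enters every other vertex, and every vertex can be reached
from `r`. -/
structure IsSpanningTree (G : SignedDigraph V) (T : V → V → Prop) (r : V) : Prop where
  sub : ∀ u v, T u v → G.Arc u v
  root : ∀ u, ¬ T u r
  parent : ∀ v, v ≠ r → ∃! u, T u v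
  reach : ∀ v, Relation.ReflTransGen T r v

/-- `T` has a directed path with `k` arcs (a sequence of `k + 1` distinct vertices in which each
vertex is joined to the next one by an arc). -/
def HasPath (T : V → V → Prop) (k : ℕ) : Prop :=
  ∃ l : List V, l.IsChain T ∧ l.Nodup ∧ l.length = k + 1

/-- The least `m` such that `G` contains a directed spanning tree whose longest directed path has
length `m`. -/
noncomputable def pStar (G : SignedDigraph V) : ℕ :=
  sInf {m | ∃ T r, G.IsSpanningTree T r ∧ IsGreatest {k | HasPath T k} m}

end SignedDigraph

/-- The signed digraph of a matrix: `(i, j)` is an arc whenever the `j i` entry is nonzero, and it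
carries the sign of that entry. -/
noncomputable def graphOf {n : ℕ} (M : Matrix (Fin n) (Fin n) ℝ) : SignedDigraph (Fin n) where
  sign i j := SignType.sign (M j i)

/-- `b` is a vector of entries `1` and `-1` whose first entry is `1`. -/
def IsClustering {n : ℕ} (b : Fin n → ℝ) : Prop :=
  (∀ i, b i = 1 ∨ b i = -1) ∧ ∀ i, i.val = 0 → b i = 1

/-- The standing assumption on the weights at the times `t = 1, 2, …`. -/
structure WeightAssumption {n : ℕ} (A : ℕ → Matrix (Fin n) (Fin n) ℝ) (β : ℝ) : Prop where
  diag_pos : ∀ t, 1 ≤ t → ∀ i, 0 < A t i i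
  row_sum : ∀ t, 1 ≤ t → ∀ i, ∑ j, |A t i j| = 1
  beta_pos : 0 < β
  beta_le : ∀ t, 1 ≤ t → ∀ i j, 0 < |A t i j| → β ≤ |A t i j|

/-- `x(t + 1) = A(t) x(t)` for `t = 1, 2, …`. -/
def IsSolution {n : ℕ} (A : ℕ → Matrix (Fin n) (Fin n) ℝ) (x : ℕ → Fin n → ℝ) : Prop :=
  ∀ t, 1 ≤ t → x (t + 1) = A t *ᵥ x t

/-- The stochastic vectors `π(1), π(2), …` form an absolute probability sequence for
`S(1), S(2), …`. -/
def IsAbsProbSeq {n : ℕ} (S : ℕ → Matrix (Fin n) (Fin n) ℝ) (π : ℕ → Fin n → ℝ) : Prop :=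
  ∀ t, 1 ≤ t → π t ∈ stdSimplex ℝ (Fin n) ∧ π t = π (t + 1) ᵥ* S t

/-- `x(t)` approaches the vector `v` as fast as `ρ ^ t` converges to zero. -/
def ConvergesAtRate {n : ℕ} (x : ℕ → Fin n → ℝ) (v : Fin n → ℝ) (ρ : ℝ) : Prop :=
  ∃ C : ℝ, ∀ t, 1 ≤ t → ∀ i, |x t i - v i| ≤ C * ρ ^ t

/-- `x(t)` reaches, as fast as `ρ ^ t` converges to zero, the nonzero modulus consensus
corresponding to `b`: the limit is a nonzero multiple of `b`. -/
def ReachesNonzeroModulusConsensus {n : ℕ} (x : ℕ → Fin n → ℝ) (b : Fin n → ℝ) (ρ : ℝ) : Prop :=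
  ∃ α : ℝ, α ≠ 0 ∧ ConvergesAtRate x (α • b) ρ

/-! ### Directed paths and shallow spanning trees -/

namespace Relation

/-! Structural balance means |A(t)| = diag(b) A(t) diag(b), so y = diag(b) x follows the averaging
iteration of the stochastic matrices |A(t)|. Along it m = π(t)'y(t) is constant, and V(t) = ∑
π_i(t)(y_i(t) - m)² serves as Lyapunov function.

Let E be the energy, the sum of |a_ij|(y_j - y_i)² over all i, j. A step lowers V by at least δβE
(`mul_sum_le_sum_sub_sq`). Conversely V ≤ (p*/β)E: V is at most the second moment about the value at
the root of a shallowest tree, and Cauchy–Schwarz along a tree path of at most p* arcs bounds each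
difference (`List.IsChain.sq_getLast_sub_le`). So V contracts by 1 - δβ²/p* ≤ ρ².

The limit is (c'x(1))b with c_i = π_i(1)b_i ≠ 0, and c'x(1) vanishes only on a hyperplane. -/

theorem ReflTransGen.exists_isChain_nodup {V : Type*} {R : V → V → Prop} {a b : V}
    (h : Relation.ReflTransGen R a b) :
    ∃ l : List V, (a :: l).IsChain R ∧ (a :: l).Nodup ∧
      (a :: l).getLast (List.cons_ne_nil a l) = b := by
  classical
  induction h using Relation.ReflTransGen.head_induction_on with
  | refl => exact ⟨[], by simp, by simp, rfl⟩
  | @head a c hac _ ih =>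
    obtain ⟨l, hc, hn, hl⟩ := ih
    by_cases ha : a ∈ c :: l
    -- A loop through `a`: keep only the part of the path after it.
    · obtain ⟨s, t, hst⟩ := List.append_of_mem ha
      rw [hst] at hc hn
      refine ⟨t, hc.right_of_append, hn.of_append_right, ?_⟩
      rw [← hl]
      simp [hst]
    · exact ⟨c :: l, List.isChain_cons_cons.2 ⟨hac, hc⟩, List.nodup_cons.2 ⟨ha, hn⟩, by simpa using hl⟩

end Relation

namespace SignedDigraph

variable {V : Type*}

/-- `G` has a directed walk with `k` arcs from `r` to the given vertex. -/
def WalkFrom (G : SignedDigraph V) (r : V) : ℕ → V → Prop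
  | 0, v => v = r
  | k + 1, v => ∃ u, WalkFrom G r k u ∧ G.Arc u v

theorem exists_walkFrom {G : SignedDigraph V} {r v : V} (h : Relation.ReflTransGen G.Arc r v) :
    ∃ k, G.WalkFrom r k v := by
  induction h with
  | refl => exact ⟨0, rfl⟩
  | tail _ hbc ih =>
    obtain ⟨k, hk⟩ := ih
    exact ⟨k + 1, _, hk, hbc⟩

/-- A strongly connected digraph has a (breadth-first) spanning tree with any given root. -/
theorem StronglyConnected.exists_isSpanningTree {G : SignedDigraph V} (hG : G.StronglyConnected)
    (r : V) : ∃ T, G.IsSpanningTree T r := by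
  classical
  have hex : ∀ v, ∃ k, G.WalkFrom r k v := fun v => exists_walkFrom (hG r v)
  -- The parent is the penultimate vertex of a shortest walk from `r`; distance drops along parents,
  -- so they lead back to `r`.
  have hpar : ∀ v, ∃ u, v ≠ r → G.Arc u v ∧ Nat.find (hex u) < Nat.find (hex v) := by
    intro v
    by_cases hv : v = r
    · exact ⟨r, fun h => absurd hv h⟩
    · have hs := Nat.find_spec (hex v)
      rcases hk : Nat.find (hex v) with _ | k
      · rw [hk] at hs
        exact absurd hs hv
      · rw [hk] at hs
        obtain ⟨u, hu, ha⟩ := hs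
        exact ⟨u, fun _ => ⟨ha, Nat.lt_succ_of_le (Nat.find_min' (hex u) hu)⟩⟩
  choose par hpar using hpar
  refine ⟨fun u v => v ≠ r ∧ u = par v, ?_, ?_, ?_, ?_⟩
  · rintro u v ⟨hv, rfl⟩
    exact (hpar v hv).1
  · rintro u ⟨h, -⟩
    exact h rfl
  · exact fun v hv => ⟨par v, ⟨hv, rfl⟩, fun u hu => hu.2⟩
  · intro v
    induction hd : Nat.find (hex v) using Nat.strong_induction_on generalizing v with
    | _ d ih =>
      by_cases hv : v = r
      · rw [hv]
      · exact (ih _ (hd ▸ (hpar v hv).2) (par v) rfl).tail ⟨hv, rfl⟩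

theorem HasPath.lt_card [Fintype V] {T : V → V → Prop} {k : ℕ} (h : HasPath T k) :
    k < Fintype.card V := by
  obtain ⟨l, -, hn, hl⟩ := h
  have := hn.length_le_card
  omega

theorem StronglyConnected.exists_pStar_tree [Fintype V] [Nonempty V] {G : SignedDigraph V}
    (hG : G.StronglyConnected) :
    ∃ T r, G.IsSpanningTree T r ∧ IsGreatest {k | HasPath T k} G.pStar := by
  have hne : {m | ∃ T r, G.IsSpanningTree T r ∧ IsGreatest {k | HasPath T k} m}.Nonempty := by
    obtain ⟨r⟩ := ‹Nonempty V›
    obtain ⟨T, hT⟩ := hG.exists_isSpanningTree r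
    have hb : BddAbove {k | HasPath T k} := ⟨Fintype.card V, fun k hk => (HasPath.lt_card hk).le⟩
    have h0 : {k | HasPath T k}.Nonempty := ⟨0, [r], by simp, by simp, rfl⟩
    exact ⟨sSup {k | HasPath T k}, T, r, hT, Nat.sSup_mem h0 hb, fun k hk => le_csSup hb hk⟩
  exact Nat.sInf_mem hne

theorem StronglyConnected.pStar_lt_card [Fintype V] [Nonempty V] {G : SignedDigraph V}
    (hG : G.StronglyConnected) : G.pStar < Fintype.card V := by
  obtain ⟨T, r, -, h⟩ := hG.exists_pStar_tree
  exact HasPath.lt_card h.1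

/-- Some vertex reaches every vertex by a directed path with at most `pStar` arcs. -/
theorem StronglyConnected.exists_root [Fintype V] [Nonempty V] {G : SignedDigraph V}
    (hG : G.StronglyConnected) :
    ∃ r, ∀ v, ∃ l : List V, (r :: l).IsChain G.Arc ∧ (r :: l).Nodup ∧
      (r :: l).getLast (List.cons_ne_nil r l) = v ∧ l.length ≤ G.pStar := by
  obtain ⟨T, r, hT, hg⟩ := hG.exists_pStar_tree
  refine ⟨r, fun v => ?_⟩
  obtain ⟨l, hc, hn, hl⟩ := (hT.reach v).exists_isChain_nodup
  exact ⟨l, hc.imp hT.sub, hn, hl, hg.2 ⟨r :: l, hc, hn, rfl⟩⟩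

/-- A second vertex needs an arc to be reached. This keeps the denominator 4p* positive. -/
theorem StronglyConnected.pStar_pos [Fintype V] [Nontrivial V] {G : SignedDigraph V}
    (hG : G.StronglyConnected) : 0 < G.pStar := by
  obtain ⟨r, hr⟩ := hG.exists_root
  obtain ⟨v, hv⟩ := exists_ne r
  obtain ⟨l, -, -, hl, hle⟩ := hr v
  cases l with
  | nil => exact absurd hl.symm (by simpa using hv)
  | cons a l => simp at hle; omega

end SignedDigraph

/-! ### Crossing arcs and energy along a path -/

theorem Relation.ReflTransGen.exists_crossing {V : Type*} {R : V → V → Prop} {Q : V → Prop}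
    {a b : V} (h : Relation.ReflTransGen R a b) (ha : ¬ Q a) (hb : Q b) :
    ∃ u v, ¬ Q u ∧ Q v ∧ R u v := by
  induction h with
  | refl => exact absurd hb ha
  | @tail b c _ hbc ih =>
    by_cases hQ : Q b
    · exact ih hQ
    · exact ⟨b, c, hQ, hb, hbc⟩

/-- Telescoping; each arc is charged to its head, so on a path without repetition no vertex is
charged twice. -/
theorem List.IsChain.abs_getLast_sub_le {V : Type*} {R : V → V → Prop} {w h : V → ℝ}
    (hw : ∀ u v, R u v → |w v - w u| ≤ h v) (l : List V) (a : V) (hc : (a :: l).IsChain R) :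
    |w ((a :: l).getLast (List.cons_ne_nil a l)) - w a| ≤ (l.map h).sum := by
  induction l generalizing a with
  | nil => simp
  | cons c l ih =>
    rw [List.isChain_cons_cons] at hc
    have h1 := ih c hc.2
    have h2 := hw a c hc.1
    rw [List.getLast_cons (List.cons_ne_nil c l), List.map_cons, List.sum_cons]
    calc _ ≤ _ := abs_sub_le _ (w c) _
      _ ≤ _ := by linarith

/-- The squared difference of the ends of a path is at most its length times the total energy. -/
theorem List.IsChain.sq_getLast_sub_le {V : Type*} [Fintype V] {R : V → V → Prop} {w g : V → ℝ}
    (hg : ∀ v, 0 ≤ g v) (hw : ∀ u v, R u v → (w v - w u) ^ 2 ≤ g v) {l : List V} {a : V}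
    (hc : (a :: l).IsChain R) (hn : (a :: l).Nodup) :
    (w ((a :: l).getLast (List.cons_ne_nil a l)) - w a) ^ 2 ≤ l.length * ∑ v, g v := by
  classical
  have h1 := hc.abs_getLast_sub_le (h := fun v => √(g v))
    (fun u v huv => Real.abs_le_sqrt (hw u v huv))
  have hn' : l.Nodup := (List.nodup_cons.1 hn).2
  rw [← List.sum_toFinset _ hn'] at h1
  calc _ = |w ((a :: l).getLast (List.cons_ne_nil a l)) - w a| ^ 2 := (sq_abs _).symm
    _ ≤ (∑ v ∈ l.toFinset, √(g v)) ^ 2 := by gcongr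
    _ ≤ (l.toFinset.card : ℝ) * ∑ v ∈ l.toFinset, √(g v) ^ 2 := sq_sum_le_card_mul_sum_sq
    _ = l.length * ∑ v ∈ l.toFinset, g v := by
      rw [List.toFinset_card_of_nodup hn']
      simp only [Real.sq_sqrt (hg _)]
    _ ≤ _ := by
      exact mul_le_mul_of_nonneg_left
        (Finset.sum_le_sum_of_subset_of_nonneg (Finset.subset_univ _) fun v _ _ => hg v)
        (Nat.cast_nonneg _)

/-! ### Absolute probability sequences -/

theorem Matrix.vecMul_mem_stdSimplex {ι : Type*} [Fintype ι] {S : Matrix ι ι ℝ}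
    (h0 : ∀ i j, 0 ≤ S i j) (h1 : ∀ i, ∑ j, S i j = 1) {v : ι → ℝ} (hv : v ∈ stdSimplex ℝ ι) :
    v ᵥ* S ∈ stdSimplex ℝ ι := by
  refine ⟨fun j => Finset.sum_nonneg fun i _ => mul_nonneg (hv.1 i) (h0 i j), ?_⟩
  simp only [Matrix.vecMul, dotProduct]
  rw [Finset.sum_comm]
  simp only [← Finset.mul_sum, h1, mul_one, hv.2]

/-- Kolmogorov: every sequence of stochastic matrices has an absolute probability sequence. -/
theorem exists_isAbsProbSeq {n : ℕ} [NeZero n] {S : ℕ → Matrix (Fin n) (Fin n) ℝ}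
    (h0 : ∀ t, 1 ≤ t → ∀ i j, 0 ≤ S t i j) (h1 : ∀ t, 1 ≤ t → ∀ i, ∑ j, S t i j = 1) :
    ∃ π, IsAbsProbSeq S π := by
  -- Nested compact sets (Tychonoff) of sequences satisfying the first `N` relations. Index 0 stands
  -- for time 1.
  let K : ℕ → Set (ℕ → Fin n → ℝ) := fun N =>
    (Set.univ.pi fun _ => stdSimplex ℝ (Fin n)) ∩
      ⋂ t, ⋂ (_ : t < N), {π | π t = π (t + 1) ᵥ* S (t + 1)}
  have hcl : ∀ N, IsClosed (⋂ t, ⋂ (_ : t < N),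
      {π : ℕ → Fin n → ℝ | π t = π (t + 1) ᵥ* S (t + 1)}) := by
    intro N
    refine isClosed_iInter fun t => isClosed_iInter fun _ => isClosed_eq (continuous_apply t) ?_
    exact (continuous_apply (t + 1)).matrix_vecMul continuous_const
  have hK0 : IsCompact (Set.univ.pi fun _ : ℕ => stdSimplex ℝ (Fin n)) :=
    isCompact_univ_pi fun _ => isCompact_stdSimplex ℝ (Fin n)
  have hK : ∀ N, IsCompact (K N) := fun N => hK0.inter_right (hcl N)
  have hmono : ∀ N, K (N + 1) ⊆ K N := fun N π hπ =>
    ⟨hπ.1, by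
      have := hπ.2
      simp only [Set.mem_iInter] at this ⊢
      exact fun t ht => this t (by omega)⟩
  have hne : ∀ N, (K N).Nonempty := by
    intro N
    -- Backward recursion from an arbitrary terminal vector.
    let f : ℕ → Fin n → ℝ := fun k =>
      Nat.rec (Pi.single 0 1) (fun k v => v ᵥ* S (N - k)) k
    have hfs : ∀ k, f (k + 1) = f k ᵥ* S (N - k) := fun _ => rfl
    have hf : ∀ k, k ≤ N → f k ∈ stdSimplex ℝ (Fin n) := by
      intro k
      induction k with
      | zero => exact fun _ => single_mem_stdSimplex ℝ 0
      | succ k ih =>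
        intro hk
        rw [hfs]
        exact vecMul_mem_stdSimplex (h0 _ (by omega)) (h1 _ (by omega)) (ih (by omega))
    refine ⟨fun t => f (N - t), fun t _ => hf _ (Nat.sub_le _ _), ?_⟩
    simp only [Set.mem_iInter, Set.mem_ofPred_eq]
    intro t ht
    have e1 : N - t = (N - (t + 1)) + 1 := by omega
    have e2 : N - (N - (t + 1)) = t + 1 := by omega
    rw [e1, hfs, e2]
  obtain ⟨π, hπ⟩ := IsCompact.nonempty_iInter_of_sequence_nonempty_isCompact_isClosed K hmono hne
    (hK 0) fun N => (hK N).isClosed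
  rw [Set.mem_iInter] at hπ
  refine ⟨fun t => π (t - 1), fun t ht => ⟨(hπ 0).1 _ trivial, ?_⟩⟩
  have := (hπ t).2
  simp only [Set.mem_iInter, Set.mem_ofPred_eq] at this
  have h := this (t - 1) (by omega)
  rw [Nat.sub_add_cancel ht] at h
  simpa using h

theorem exists_inv_card_le_of_mem_stdSimplex {ι : Type*} [Fintype ι] {v : ι → ℝ}
    (hv : v ∈ stdSimplex ℝ ι) : ∃ i, (Fintype.card ι : ℝ)⁻¹ ≤ v i := by
  by_contra! h
  have hne : (Finset.univ : Finset ι).Nonempty := by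
    by_contra hne
    have := hv.2
    rw [Finset.not_nonempty_iff_eq_empty.1 hne] at this
    simp at this
  have h1 := Finset.sum_lt_sum_of_nonempty hne fun i _ => h i
  have hc : (Fintype.card ι : ℝ) ≠ 0 := by
    have := Finset.card_pos.2 hne
    rw [Finset.card_univ] at this
    positivity
  rw [hv.2] at h1
  simp [mul_inv_cancel₀ hc] at h1

/-- The entries of an absolute probability sequence of strongly connected stochastic matrices with
positive diagonals are bounded away from zero. -/
theorem IsAbsProbSeq.pow_div_le {n : ℕ} {S : ℕ → Matrix (Fin n) (Fin n) ℝ} {π : ℕ → Fin n → ℝ}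
    (hπ : IsAbsProbSeq S π) {β : ℝ} (hβ : 0 < β) (h0 : ∀ t, 1 ≤ t → ∀ i j, 0 ≤ S t i j)
    (hS : ∀ t, 1 ≤ t → ∀ i j, S t i j ≠ 0 → β ≤ S t i j) (hd : ∀ t, 1 ≤ t → ∀ i, S t i i ≠ 0)
    (hc : ∀ t, 1 ≤ t → ∀ i j, Relation.ReflTransGen (fun u v => S t v u ≠ 0) i j)
    {t : ℕ} (ht : 1 ≤ t) (i : Fin n) : β ^ n * (n : ℝ)⁻¹ ≤ π t i := by
  classical
  have step : ∀ s, 1 ≤ s → ∀ i j, S s j i ≠ 0 → ∀ c, 0 ≤ c → c ≤ π (s + 1) j →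
      β * c ≤ π s i := by
    intro s hs i j hij c hc0 hcj
    rw [(hπ s hs).2]
    have hp := (hπ (s + 1) (by omega)).1.1
    calc β * c ≤ π (s + 1) j * S s j i := by
          rw [mul_comm]
          exact mul_le_mul hcj (hS s hs j i hij) hβ.le (hp j)
      _ ≤ _ := Finset.single_le_sum (f := fun j => π (s + 1) j * S s j i)
          (fun j _ => mul_nonneg (hp j) (h0 s hs j i)) (Finset.mem_univ j)
  -- Going back from time `t + n`, where some entry is at least 1/n, each step costs a factor β and
  -- the set gains a vertex until it is full.
  let Q : ℕ → Finset (Fin n) := fun k =>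
    Finset.univ.filter fun i => β ^ k * (n : ℝ)⁻¹ ≤ π (t + (n - k)) i
  have hQ : ∀ k i, i ∈ Q k ↔ β ^ k * (n : ℝ)⁻¹ ≤ π (t + (n - k)) i := by simp [Q]
  have key : ∀ k, k < n → ∀ i j, S (t + (n - (k + 1))) j i ≠ 0 → j ∈ Q k → i ∈ Q (k + 1) := by
    intro k hk i j hij hj
    rw [hQ] at hj ⊢
    have e : t + (n - k) = t + (n - (k + 1)) + 1 := by omega
    rw [e] at hj
    rw [pow_succ', mul_assoc]
    exact step _ (by omega) i j hij _ (by positivity) hj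
  have hcard : ∀ k, k ≤ n → k ≤ (Q k).card ∧ (Q k).Nonempty := by
    intro k
    induction k with
    | zero =>
      intro _
      obtain ⟨j, hj⟩ := exists_inv_card_le_of_mem_stdSimplex (hπ (t + (n - 0)) (by omega)).1
      exact ⟨by omega, j, (hQ 0 j).2 (by simpa using hj)⟩
    | succ k ih =>
      intro hk
      obtain ⟨h1, j, hj⟩ := ih (by omega)
      have hsub : Q k ⊆ Q (k + 1) := fun i hi => key k hk i i (hd _ (by omega) i) hi
      refine ⟨?_, j, hsub hj⟩
      by_cases hall : ∀ i, i ∈ Q k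
      · have : Q (k + 1) = Finset.univ := Finset.eq_univ_of_forall fun i => hsub (hall i)
        rw [this]
        simpa using hk
      · push Not at hall
        obtain ⟨i, hi⟩ := hall
        obtain ⟨u, v, hu, hv, huv⟩ := (hc (t + (n - (k + 1))) (by omega) i j).exists_crossing
          (Q := fun x => x ∈ Q k) hi hj
        have hss : Q k ⊂ Q (k + 1) :=
          (Finset.ssubset_iff_of_subset hsub).2 ⟨u, key k hk u v huv hv, hu⟩
        have := Finset.card_lt_card hss
        omega
  have hu : Q n = Finset.univ := by
    apply Finset.eq_univ_of_card
    have h1 := (hcard n le_rfl).1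
    have h2 := Finset.card_le_univ (Q n)
    simp only [Fintype.card_fin] at h2 ⊢
    omega
  have := (hQ n i).1 (hu ▸ Finset.mem_univ i)
  simpa using this

/-! ### Contraction of the weighted variance -/

/-- A lower bound for the variance of a stochastic row with a positive weight at `i`. -/
theorem mul_sum_le_sum_sub_sq {ι : Type*} [Fintype ι] {s w : ι → ℝ} (h0 : ∀ j, 0 ≤ s j)
    (h1 : ∑ j, s j = 1) (i : ι) :
    s i * ∑ j, s j * (w j - w i) ^ 2 ≤ ∑ j, s j * w j ^ 2 - (∑ j, s j * w j) ^ 2 := by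
  classical
  have e1 : ∑ j, s j * (w j - w i) = ∑ j, s j * w j - w i := by
    simp only [mul_sub, Finset.sum_sub_distrib, ← Finset.sum_mul, h1, one_mul]
  have e2 : ∑ j, s j * (w j - w i) ^ 2
      = ∑ j, s j * w j ^ 2 - 2 * w i * ∑ j, s j * w j + w i ^ 2 := by
    rw [Finset.mul_sum, ← Finset.sum_sub_distrib]
    conv_rhs => rw [← one_mul (w i ^ 2), ← h1, Finset.sum_mul, ← Finset.sum_add_distrib]
    exact Finset.sum_congr rfl fun j _ => by ring
  have herase : ∀ f : ι → ℝ, ∑ j, f j = ∑ j ∈ Finset.univ.erase i, f j + f i := fun f =>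
    (Finset.sum_erase_add _ _ (Finset.mem_univ i)).symm
  -- Cauchy–Schwarz over j ≠ i: the term at `i` vanishes and the other weights sum to 1 - s i.
  have hcs : (∑ j, s j * (w j - w i)) ^ 2 ≤ (1 - s i) * ∑ j, s j * (w j - w i) ^ 2 := by
    rw [herase fun j => s j * (w j - w i), herase fun j => s j * (w j - w i) ^ 2, ← h1, herase s]
    simp only [sub_self, mul_zero, add_zero, add_sub_cancel_right, ne_eq, OfNat.ofNat_ne_zero,
      not_false_eq_true, zero_pow]
    exact Finset.sum_sq_le_sum_mul_sum_of_sq_le_mul _ (fun j _ => h0 j)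
      (fun j _ => mul_nonneg (h0 j) (sq_nonneg _)) fun j _ => le_of_eq (by ring)
  have e3 : (∑ j, s j * (w j - w i)) ^ 2
      = (∑ j, s j * w j) ^ 2 - 2 * w i * ∑ j, s j * w j + w i ^ 2 := by
    rw [e1]; ring
  linarith

/-- The weighted second moment about the weighted mean is minimal. -/
theorem sum_mul_sq_le_of_sum_mul_eq_zero {ι : Type*} [Fintype ι] {q w : ι → ℝ}
    (h1 : ∑ i, q i = 1) (hm : ∑ i, q i * w i = 0) (a : ℝ) :
    ∑ i, q i * w i ^ 2 ≤ ∑ i, q i * (w i - a) ^ 2 := by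
  have : ∑ i, q i * (w i - a) ^ 2
      = ∑ i, q i * w i ^ 2 - 2 * a * ∑ i, q i * w i + a ^ 2 * ∑ i, q i := by
    rw [Finset.mul_sum, Finset.mul_sum, ← Finset.sum_sub_distrib, ← Finset.sum_add_distrib]
    exact Finset.sum_congr rfl fun i _ => by ring
  rw [this, hm, h1]
  nlinarith [sq_nonneg a]

/-- One step of the averaging iteration contracts the weighted variance. -/
theorem sum_mul_sq_mulVec_le {ι : Type*} [Fintype ι] {S : Matrix ι ι ℝ} {β δ p : ℝ} (hβ : 0 < β)
    (hδ : 0 < δ) (hp : 0 < p) (h0 : ∀ i j, 0 ≤ S i j) (h1 : ∀ i, ∑ j, S i j = 1)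
    (hS : ∀ i j, S i j ≠ 0 → β ≤ S i j) (hd : ∀ i, S i i ≠ 0) {r : ι}
    (hr : ∀ v, ∃ l : List ι, (r :: l).IsChain (fun u v => S v u ≠ 0) ∧ (r :: l).Nodup ∧
      (r :: l).getLast (List.cons_ne_nil r l) = v ∧ (l.length : ℝ) ≤ p)
    {q : ι → ℝ} (hq : ∀ i, δ ≤ q i) (hqS : ∑ i, (q ᵥ* S) i = 1) (hq0 : ∀ i, 0 ≤ (q ᵥ* S) i)
    {w : ι → ℝ} (hw : ∑ i, (q ᵥ* S) i * w i = 0) :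
    ∑ i, q i * (S *ᵥ w) i ^ 2 ≤ (1 - δ * β ^ 2 / p) * ∑ i, (q ᵥ* S) i * w i ^ 2 := by
  set g : ι → ℝ := fun i => ∑ j, S i j * (w j - w i) ^ 2 with hg
  have hg0 : ∀ i, 0 ≤ g i := fun i =>
    Finset.sum_nonneg fun j _ => mul_nonneg (h0 i j) (sq_nonneg _)
  have hswap : ∑ i, (q ᵥ* S) i * w i ^ 2 = ∑ i, q i * ∑ j, S i j * w j ^ 2 := by
    simp only [Matrix.vecMul, dotProduct, Finset.sum_mul, Finset.mul_sum]
    rw [Finset.sum_comm]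
    simp only [mul_assoc]
  have hdec : δ * β * ∑ i, g i
      ≤ ∑ i, (q ᵥ* S) i * w i ^ 2 - ∑ i, q i * (S *ᵥ w) i ^ 2 := by
    rw [hswap, ← Finset.sum_sub_distrib, Finset.mul_sum]
    refine Finset.sum_le_sum fun i _ => ?_
    have hrow := mul_sum_le_sum_sub_sq (w := w) (h0 i) (h1 i) i
    have hb : β * g i ≤ ∑ j, S i j * w j ^ 2 - (S *ᵥ w) i ^ 2 :=
      (mul_le_mul_of_nonneg_right (hS i i (hd i)) (hg0 i)).trans hrow
    rw [mul_assoc, ← mul_sub]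
    exact mul_le_mul (hq i) hb (mul_nonneg hβ.le (hg0 i)) (hδ.le.trans (hq i))
  have hedge : ∀ u v, S v u ≠ 0 → (w v - w u) ^ 2 ≤ g v / β := by
    intro u v huv
    rw [le_div_iff₀ hβ]
    calc (w v - w u) ^ 2 * β ≤ S v u * (w u - w v) ^ 2 := by
          have := mul_le_mul_of_nonneg_right (hS v u huv) (sq_nonneg (w u - w v))
          linarith [sub_sq_comm (w u) (w v)]
      _ ≤ g v := Finset.single_le_sum (f := fun u => S v u * (w u - w v) ^ 2)
          (fun u _ => mul_nonneg (h0 v u) (sq_nonneg _)) (Finset.mem_univ u)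
  have hpt : ∀ v, (w v - w r) ^ 2 ≤ p * ((∑ i, g i) / β) := by
    intro v
    obtain ⟨l, hc, hn, hl, hlen⟩ := hr v
    have := hc.sq_getLast_sub_le (g := fun v => g v / β)
      (fun v => div_nonneg (hg0 v) hβ.le) hedge hn
    rw [hl, ← Finset.sum_div] at this
    exact this.trans (mul_le_mul_of_nonneg_right hlen
      (div_nonneg (Finset.sum_nonneg fun i _ => hg0 i) hβ.le))
  have hV : ∑ i, (q ᵥ* S) i * w i ^ 2 ≤ p * ((∑ i, g i) / β) :=
    calc _ ≤ ∑ i, (q ᵥ* S) i * (w i - w r) ^ 2 := sum_mul_sq_le_of_sum_mul_eq_zero hqS hw (w r)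
      _ ≤ ∑ i, (q ᵥ* S) i * (p * ((∑ i, g i) / β)) :=
        Finset.sum_le_sum fun i _ => mul_le_mul_of_nonneg_left (hpt i) (hq0 i)
      _ = _ := by rw [← Finset.sum_mul, hqS, one_mul]
  have hfin : δ * β ^ 2 / p * ∑ i, (q ᵥ* S) i * w i ^ 2 ≤ δ * β * ∑ i, g i :=
    calc _ ≤ δ * β ^ 2 / p * (p * ((∑ i, g i) / β)) :=
          mul_le_mul_of_nonneg_left hV (by positivity)
      _ = _ := by field_simp
  linarith

/-- Geometric convergence of an averaging iteration to the mean given by an absolute probability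
sequence. -/
theorem IsAbsProbSeq.abs_sub_le {n : ℕ} {S : ℕ → Matrix (Fin n) (Fin n) ℝ} {π : ℕ → Fin n → ℝ}
    (hπ : IsAbsProbSeq S π) {β δ p ρ : ℝ} (hβ : 0 < β) (hδ : 0 < δ) (hp : 0 < p)
    (h0 : ∀ t, 1 ≤ t → ∀ i j, 0 ≤ S t i j) (h1 : ∀ t, 1 ≤ t → ∀ i, ∑ j, S t i j = 1)
    (hS : ∀ t, 1 ≤ t → ∀ i j, S t i j ≠ 0 → β ≤ S t i j) (hd : ∀ t, 1 ≤ t → ∀ i, S t i i ≠ 0)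
    (hr : ∀ t, 1 ≤ t → ∃ r, ∀ v, ∃ l : List (Fin n), (r :: l).IsChain (fun u v => S t v u ≠ 0) ∧
      (r :: l).Nodup ∧ (r :: l).getLast (List.cons_ne_nil r l) = v ∧ (l.length : ℝ) ≤ p)
    (hδπ : ∀ t, 1 ≤ t → ∀ i, δ ≤ π t i) (hρ : 0 < ρ) (hρp : 1 - δ * β ^ 2 / p ≤ ρ ^ 2)
    {y : ℕ → Fin n → ℝ} (hy : ∀ t, 1 ≤ t → y (t + 1) = S t *ᵥ y t) :
    ∃ C, ∀ t, 1 ≤ t → ∀ i, |y t i - π 1 ⬝ᵥ y 1| ≤ C * ρ ^ t := by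
  have hmean : ∀ t, π (t + 1) ⬝ᵥ y (t + 1) = π 1 ⬝ᵥ y 1 := by
    intro t
    induction t with
    | zero => rfl
    | succ t ih =>
      rw [← ih, hy (t + 1) (by omega), Matrix.dotProduct_mulVec, ← (hπ (t + 1) (by omega)).2]
  set m := π 1 ⬝ᵥ y 1
  let V : ℕ → ℝ := fun t => ∑ i, π t i * (y t i - m) ^ 2
  have hV0 : ∀ t, 1 ≤ t → 0 ≤ V t := fun t ht =>
    Finset.sum_nonneg fun i _ => mul_nonneg ((hπ t ht).1.1 i) (sq_nonneg _)
  have hstep : ∀ t, V (t + 1 + 1) ≤ ρ ^ 2 * V (t + 1) := by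
    intro t
    have ht : 1 ≤ t + 1 := by omega
    obtain ⟨r, hr⟩ := hr (t + 1) ht
    have hππ := (hπ (t + 1) ht).2
    have hst := (hπ (t + 1) ht).1
    have hw : S (t + 1) *ᵥ (fun i => y (t + 1) i - m) = fun i => y (t + 1 + 1) i - m := by
      rw [hy (t + 1) ht]
      ext i
      simp only [Matrix.mulVec, dotProduct, mul_sub, Finset.sum_sub_distrib, ← Finset.sum_mul,
        h1 (t + 1) ht, one_mul]
    have := sum_mul_sq_mulVec_le hβ hδ hp (h0 (t + 1) ht) (h1 (t + 1) ht) (hS (t + 1) ht)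
      (hd (t + 1) ht) hr (hδπ (t + 1 + 1) (by omega)) (hππ ▸ hst.2) (hππ ▸ hst.1)
      (w := fun i => y (t + 1) i - m) (by
        rw [← hππ]
        have := hmean t
        simp only [dotProduct] at this
        simp only [mul_sub, Finset.sum_sub_distrib, ← Finset.sum_mul, hst.2, one_mul, this,
          sub_self])
    rw [hw, ← hππ] at this
    exact this.trans (mul_le_mul_of_nonneg_right hρp (hV0 _ ht))
  have hV : ∀ t, V (t + 1) ≤ (ρ ^ t) ^ 2 * V 1 := by
    intro t
    induction t with
    | zero => simp
    | succ t ih =>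
      calc _ ≤ ρ ^ 2 * V (t + 1) := hstep t
        _ ≤ ρ ^ 2 * ((ρ ^ t) ^ 2 * V 1) := by gcongr
        _ = _ := by ring
  -- As π_i ≥ δ, V/δ bounds each squared deviation; the division by ρ is due to starting at time 1.
  refine ⟨√(V 1 / δ) / ρ, fun t ht i => ?_⟩
  obtain ⟨t, rfl⟩ : ∃ s, t = s + 1 := ⟨t - 1, by omega⟩
  have h2 : (y (t + 1) i - m) ^ 2 ≤ (ρ ^ t) ^ 2 * (V 1 / δ) := by
    rw [← mul_div_assoc, le_div_iff₀ hδ]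
    calc _ ≤ π (t + 1) i * (y (t + 1) i - m) ^ 2 := by
          rw [mul_comm]
          exact mul_le_mul_of_nonneg_right (hδπ _ ht i) (sq_nonneg _)
      _ ≤ V (t + 1) := Finset.single_le_sum (f := fun i => π (t + 1) i * (y (t + 1) i - m) ^ 2)
          (fun i _ => mul_nonneg ((hπ _ ht).1.1 i) (sq_nonneg _)) (Finset.mem_univ i)
      _ ≤ _ := hV t
  calc _ ≤ √((ρ ^ t) ^ 2 * (V 1 / δ)) := Real.abs_le_sqrt h2
    _ = ρ ^ t * √(V 1 / δ) := by
      rw [Real.sqrt_mul (by positivity), Real.sqrt_sq (by positivity)]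
    _ = _ := by
      field_simp
      ring

/-! ### Sign change and conclusion -/

theorem ae_dotProduct_ne_zero {n : ℕ} {c : Fin n → ℝ} (hc : c ≠ 0) :
    ∀ᵐ x : Fin n → ℝ ∂volume, c ⬝ᵥ x ≠ 0 := by
  let L : (Fin n → ℝ) →ₗ[ℝ] ℝ := dotProductBilin ℝ ℝ c
  have hL : LinearMap.ker L ≠ ⊤ := by
    intro h
    have : c ∈ LinearMap.ker L := h ▸ Submodule.mem_top
    exact hc (dotProduct_self_eq_zero.1 this)
  have := Measure.addHaar_submodule (volume : Measure (Fin n → ℝ)) _ hL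
  filter_upwards [measure_eq_zero_iff_ae_notMem.1 this] with x hx h
  exact hx h

/-- A nonzero entry has sign b_i b_j. This reduces the signed system to averaging. -/
theorem abs_eq_mul_mul_of_structurallyBalanced {n : ℕ} {M : Matrix (Fin n) (Fin n) ℝ}
    {b : Fin n → ℝ} (hb : ∀ i, b i = 1 ∨ b i = -1) (h : (graphOf M).StructurallyBalanced b)
    (i j : Fin n) : |M i j| = b i * M i j * b j := by
  by_cases h0 : M i j = 0
  · simp [h0]
  · have hij := h j i (by simpa [SignedDigraph.Arc, graphOf] using h0)
    simp only [graphOf] at hij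
    by_cases hbb : b j = b i
    · rw [abs_of_pos (sign_eq_one_iff.1 (hij.1 hbb)), hbb]
      rcases hb i with h | h <;> simp [h]
    · rw [abs_of_neg (sign_eq_neg_one_iff.1 (hij.2 hbb))]
      rcases hb i with h | h <;> rcases hb j with h' | h' <;> simp [h, h'] at hbb ⊢

theorem proposition2 (n : ℕ) (hn : 1 < n) (A : ℕ → Matrix (Fin n) (Fin n) ℝ) (β : ℝ)
    (hA : WeightAssumption A β) (b : Fin n → ℝ) (hb : IsClustering b)
    (hconn : ∀ t, 1 ≤ t → (graphOf (A t)).StronglyConnected)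
    (hbal : ∀ t, 1 ≤ t → (graphOf (A t)).StructurallyBalanced b) :
    (∃ π, IsAbsProbSeq (fun t => (A t).map abs) π) ∧
    ∃ p : ℕ, IsGreatest {m | ∃ t, 1 ≤ t ∧ (graphOf (A t)).pStar = m} p ∧
    ∀ π, IsAbsProbSeq (fun t => (A t).map abs) π →
      (∃ δ : ℝ, 0 < δ ∧ ∀ t, 1 ≤ t → ∀ i, δ ≤ π t i) ∧
      ∀ δ : ℝ, 0 < δ → (∀ t, 1 ≤ t → ∀ i, δ ≤ π t i) →
        ∀ ρ : ℝ, ρ = 1 - δ * β ^ 2 / (4 * (p : ℝ)) →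
          0 < ρ ∧ ρ < 1 ∧
          ∃ c : Fin n → ℝ, c ≠ 0 ∧
            (∀ x, IsSolution A x → ConvergesAtRate x ((c ⬝ᵥ x 1) • b) ρ) ∧
            (∀ᵐ x₁ : Fin n → ℝ ∂volume, ∀ x, IsSolution A x → x 1 = x₁ →
              ReachesNonzeroModulusConsensus x b ρ) := by
  have : NeZero n := ⟨by omega⟩
  have : Nontrivial (Fin n) := Fin.nontrivial_iff_two_le.2 hn
  have hβ := hA.beta_pos
  have h0 : ∀ t, 1 ≤ t → ∀ i j, 0 ≤ (A t).map abs i j := fun t _ i j => abs_nonneg _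
  have h1 : ∀ t, 1 ≤ t → ∀ i, ∑ j, (A t).map abs i j = 1 := hA.row_sum
  have hS : ∀ t, 1 ≤ t → ∀ i j, (A t).map abs i j ≠ 0 → β ≤ (A t).map abs i j :=
    fun t ht i j h => hA.beta_le t ht i j ((abs_nonneg _).lt_of_ne' h)
  have hd : ∀ t, 1 ≤ t → ∀ i, (A t).map abs i i ≠ 0 :=
    fun t ht i => abs_ne_zero.2 (hA.diag_pos t ht i).ne'
  have harc : ∀ t, (graphOf (A t)).Arc = fun u v => (A t).map abs v u ≠ 0 := by
    intro t
    funext u v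
    simp [SignedDigraph.Arc, graphOf]
  have hc : ∀ t, 1 ≤ t → ∀ i j,
      Relation.ReflTransGen (fun u v => (A t).map abs v u ≠ 0) i j := by
    intro t ht
    rw [← harc t]
    exact hconn t ht
  refine ⟨exists_isAbsProbSeq h0 h1, ?_⟩
  obtain ⟨p, hp⟩ : ∃ p, IsGreatest {m | ∃ t, 1 ≤ t ∧ (graphOf (A t)).pStar = m} p := by
    have hbd : BddAbove {m | ∃ t, 1 ≤ t ∧ (graphOf (A t)).pStar = m} := by
      refine ⟨n, ?_⟩
      rintro m ⟨t, ht, rfl⟩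
      simpa using (hconn t ht).pStar_lt_card.le
    exact ⟨_, Nat.sSup_mem ⟨_, 1, le_rfl, rfl⟩ hbd, fun k hk => le_csSup hbd hk⟩
  refine ⟨p, hp, fun π hπ => ⟨⟨β ^ n * (n : ℝ)⁻¹, by positivity,
    fun t ht i => hπ.pow_div_le hβ h0 hS hd hc ht i⟩, ?_⟩⟩
  intro δ hδ hδπ ρ hρ
  have hp1 : (1 : ℝ) ≤ p := by
    obtain ⟨t, ht, hpt⟩ := hp.1
    have := (hconn t ht).pStar_pos
    rw [hpt] at this
    exact_mod_cast this
  have hδ1 : δ ≤ 1 := (hδπ 1 le_rfl 0).trans (mem_Icc_of_mem_stdSimplex (hπ 1 le_rfl).1 0).2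
  have hβ1 : β ≤ 1 := by
    refine (hS 1 le_rfl 0 0 (hd 1 le_rfl 0)).trans ?_
    rw [← h1 1 le_rfl 0]
    exact Finset.single_le_sum (f := fun j => (A 1).map abs 0 j) (fun j _ => h0 1 le_rfl 0 j)
      (Finset.mem_univ 0)
  have hε0 : 0 < δ * β ^ 2 / (4 * (p : ℝ)) := by positivity
  have hε1 : δ * β ^ 2 / (4 * (p : ℝ)) < 1 := by
    rw [div_lt_one (by positivity)]
    have : δ * β ^ 2 ≤ 1 := mul_le_one₀ hδ1 (by positivity) (pow_le_one₀ hβ.le hβ1)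
    linarith
  have hρ0 : 0 < ρ := by linarith
  -- With ε = δβ²/(4p), this is 1 - 4ε ≤ (1 - ε)², which has room to spare.
  have hρp : 1 - δ * β ^ 2 / p ≤ ρ ^ 2 := by
    have : δ * β ^ 2 / p = 4 * (δ * β ^ 2 / (4 * (p : ℝ))) := by field_simp
    rw [this, hρ]
    nlinarith
  have hr : ∀ t, 1 ≤ t → ∃ r, ∀ v, ∃ l : List (Fin n),
      (r :: l).IsChain (fun u v => (A t).map abs v u ≠ 0) ∧ (r :: l).Nodup ∧
      (r :: l).getLast (List.cons_ne_nil r l) = v ∧ (l.length : ℝ) ≤ p := by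
    intro t ht
    rw [← harc t]
    obtain ⟨r, hr⟩ := (hconn t ht).exists_root
    refine ⟨r, fun v => ?_⟩
    obtain ⟨l, h1, h2, h3, h4⟩ := hr v
    exact ⟨l, h1, h2, h3, by exact_mod_cast h4.trans (hp.2 ⟨t, ht, rfl⟩)⟩
  have hbb : ∀ i, b i * b i = 1 := fun i => by rcases hb.1 i with h | h <;> simp [h]
  have hcne : (fun i => π 1 i * b i) ≠ 0 := by
    intro h
    have h2 : π 1 0 * b 0 = 0 := congrFun h 0
    rw [hb.2 0 rfl, mul_one] at h2
    linarith [hδπ 1 le_rfl 0]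
  have hconv : ∀ x, IsSolution A x →
      ConvergesAtRate x (((fun i => π 1 i * b i) ⬝ᵥ x 1) • b) ρ := by
    intro x hx
    obtain ⟨C, hC⟩ := hπ.abs_sub_le hβ hδ (by linarith : (0 : ℝ) < p) h0 h1 hS hd hr hδπ hρ0 hρp
      (y := fun t i => b i * x t i) (by
        intro t ht
        ext i
        simp only [Matrix.mulVec, dotProduct, Matrix.map_apply, hx t ht, Finset.mul_sum]
        refine Finset.sum_congr rfl fun j _ => ?_
        rw [abs_eq_mul_mul_of_structurallyBalanced hb.1 (hbal t ht)]
        linear_combination (-(b i * A t i j * x t j)) * hbb j)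
    refine ⟨C, fun t ht i => ?_⟩
    have hm : π 1 ⬝ᵥ (fun i => b i * x 1 i) = (fun i => π 1 i * b i) ⬝ᵥ x 1 := by
      simp only [dotProduct, mul_assoc]
    have habs : |b i| = 1 := by rcases hb.1 i with h | h <;> simp [h]
    have := hC t ht i
    rw [hm] at this
    refine le_of_eq_of_le ?_ this
    rw [← one_mul |x t i - _|, ← habs, ← abs_mul]
    congr 1
    simp only [Pi.smul_apply, smul_eq_mul]
    linear_combination (-((fun i => π 1 i * b i) ⬝ᵥ x 1)) * hbb i
  refine ⟨hρ0, by linarith, _, hcne, hconv, ?_⟩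
  filter_upwards [ae_dotProduct_ne_zero hcne] with x₁ hx₁ x hx hx1
  exact ⟨_, hx1 ▸ hx₁, hconv x hx⟩
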